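/- **Definitions.** Identify a permutation of $\{1,\dots,n\}$ with its diagram $\{(i,\sigma(i))\}$. For a set $B$ of permutations, $Av(B)$ is the set of permutations containing no $\pi\in B$ as a pattern. A permutation of length $n$ is *simple* if it maps no interval $\{i,\dots,i+l\}$ onto an interval $\{j,\dots,j+l\}$ except when $l=0$ or $l=n-1$. The class $Av(B)$ with basis $B$ (a finite or infinite antichain for pattern containment) is *wreath-closed* if all elements of $B$ are simple. A *pin* is a point of $\mathbb Z^2$. A pin *separates* $P$ from $Q$ if the horizontal or the vertical line through it has $P$ strictly on one side and $Q$ strictly on the other; it is *independent* from $S$ if it does not separate $S$ into two nonempty sets. A *pin sequence* is a sequence of pins $(p_1,\dots,p_n)$, no two in the same row or column, such that every $p_i$ with $i\ge2$ lies outside the bounding box of $\{p_1,\dots,p_{i-1}\}$ and either separates $p_{i-1}$ from $\{p_1,\dots,p_{i-2}\}$ or is independent from $\{p_1,\dots,p_{i-1}\}$. It is a *pin representation* of $\sigma$ if it is order isomorphic to the diagram of $\sigma$, and it is *proper* if every $p_i$ with $i\ge 3$ separates $p_{i-1}$ from $\{p_1,\dots,p_{i-2}\}$. A *proper pin-permutation*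 is a permutation with a proper pin representation. A *pin word* of $\sigma$ is obtained from a pin representation $(p_1,\dots,p_n)$ of $\sigma$ and an origin $p_0$ such that $(p_0,p_1,\dots,p_n)$ is a pin sequence, by encoding each $p_i$, $i\ge1$, by a letter: $U$, $D$, $L$ or $R$ if $i\geq 2$ and $p_i$ separates $p_{i-1}$ from $\{p_0,\dots,p_{i-2}\}$ and lies above, below, to the left or to the right of $\{p_0,\dots,p_{i-1}\}$ respectively; $1$, $2$, $3$ or $4$ if $p_i$ is independent from $\{p_0,\dots,p_{i-1}\}$ and lies up-right, up-left, bottom-left or bottom-right of its bounding box respectively. A pin word of length at least $2$ is *strict* (resp. *quasi-strict*) if it consists of one numeral (resp. two numerals) followed only by directions. Let $M$ be the set of words of length at least $3$ over $\{L,R,U,D\}$ in which letters of $\{L,R\}$ and of $\{U,D\}$ alternate. For a numeral $q$, a direction $d$ and a word $u$ over $\{L,R,U,D\}$, let $\phi(qdu)=\varphi(qd)\,u$, where $\varphi(qd)=h\,v\,d$ if $d\in\{L,R\}$ and $\varphi(qd)=v\,h\,d$ if $d\in\{U,D\}$, with $(h,v)=(R,U),(L,U),(L,D),(R,D)$ for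 $q=1,2,3,4$ respectively; for a single numeral $q$, $\phi(q)$ takes the two values $hv$ and $vh$. Let $E(\pi)$ be the set of all $\phi(u)$ with $u$ a strict pin word of $\pi$, together with all words $v\in M$ of the form $v=x\,\phi(u_2\cdots u_{|u|})$ with $u$ a quasi-strict pin word of $\pi$ and $x\in\{LU,LD,RU,RD,UL,UR,DL,DR\}$ (for $|u|=2$ either value of $\phi(u_2)$ is allowed). **Theorem.** Let $Av(B)$ be a wreath-closed class with basis $B$, all elements of which have length at least $2$, and let $$F=\bigcup_{\pi\in B}E(\pi)\ \cup\ \{LL,LR,RR,RL,UU,UD,DD,DU\}.$$ If $B$ is finite, then $F$ is finite. The class $Av(B)$ contains arbitrarily long proper pin-permutations if and only if there exist arbitrarily long words over $\{L,R,U,D\}$ having no element of $F$ as a factor. Equivalently, $Av(B)$ contains only finitely many proper pin-permutations if and only if the language of words over $\{L,R,U,D\}$ having no element of $F$ as a factor is finite. -/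

import Mathlib

/-! ### Permutations, patterns, classes -/

namespace PinPerm

/-- A finite permutation, together with its length `n`, as a bijection of `{0, …, n - 1}`. -/
abbrev FinPerm : Type := Σ n : ℕ, Equiv.Perm (Fin n)

/-- The length of a permutation. -/
abbrev FinPerm.size (σ : FinPerm) : ℕ := σ.1

/-- `π` is a pattern of `σ`: some subsequence of `σ` is order isomorphic to `π`. -/
def IsPattern (π σ : FinPerm) : Prop :=
  ∃ f : Fin π.1 ↪o Fin σ.1, ∀ i j : Fin π.1, π.2 i < π.2 j ↔ σ.2 (f i) < σ.2 (f j)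

/-- `Av(B)`: the permutations avoiding every element of `B`. -/
def Av (B : Set FinPerm) : Set FinPerm :=
  {σ | ∀ π ∈ B, ¬ IsPattern π σ}

/-- A permutation is simple if it maps no interval `{i, …, i + l}` of positions onto an interval
`{j, …, j + l}` of values, except for `l = 0` and for the whole permutation. -/
def IsSimple (σ : FinPerm) : Prop :=
  ∀ i j l : ℕ, i + l < σ.1 → j + l < σ.1 →
    (∀ a : Fin σ.1, (i ≤ (a : ℕ) ∧ (a : ℕ) ≤ i + l) ↔
      (j ≤ (σ.2 a : ℕ) ∧ (σ.2 a : ℕ) ≤ j + l)) →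
    l = 0 ∨ (i = 0 ∧ j = 0 ∧ l + 1 = σ.1)

/-- `B` is the basis of a wreath-closed class: an antichain for pattern containment (finite or
infinite) all of whose elements are simple. -/
structure IsWreathClosedBasis (B : Set FinPerm) : Prop where
  antichain : IsAntichain IsPattern B
  simple : ∀ π ∈ B, IsSimple π

/-! ### Pins and pin sequences -/

/-- A pin is a point of the plane with integer coordinates. -/
abbrev Pin : Type := ℤ × ℤ

/-- The vertical line through `p` has `P` strictly on one side and `Q` strictly on the other. -/
def SeparatesVertically (p : Pin) (P Q : Set Pin) : Prop :=
  ((∀ a ∈ P, a.1 < p.1) ∧ (∀ b ∈ Q, p.1 < b.1)) ∨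
  ((∀ a ∈ P, p.1 < a.1) ∧ (∀ b ∈ Q, b.1 < p.1))

/-- The horizontal line through `p` has `P` strictly on one side and `Q` strictly on the other. -/
def SeparatesHorizontally (p : Pin) (P Q : Set Pin) : Prop :=
  ((∀ a ∈ P, a.2 < p.2) ∧ (∀ b ∈ Q, p.2 < b.2)) ∨
  ((∀ a ∈ P, p.2 < a.2) ∧ (∀ b ∈ Q, b.2 < p.2))

/-- `p` separates `P` from `Q`, vertically or horizontally. -/
def Separates (p : Pin) (P Q : Set Pin) : Prop :=
  SeparatesVertically p P Q ∨ SeparatesHorizontally p P Q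

/-- `p` is independent from `S`: it does not separate `S` into two nonempty sets. -/
def Independent (p : Pin) (S : Set Pin) : Prop :=
  ¬ ∃ P Q : Set Pin, P.Nonempty ∧ Q.Nonempty ∧ P ∪ Q = S ∧ Separates p P Q

/-- `p` lies in the bounding box of `S`. -/
def InBoundingBox (p : Pin) (S : Set Pin) : Prop :=
  ((∃ a ∈ S, a.1 ≤ p.1) ∧ (∃ a ∈ S, p.1 ≤ a.1)) ∧
  ((∃ a ∈ S, a.2 ≤ p.2) ∧ (∃ a ∈ S, p.2 ≤ a.2))

/-- The set of the first `m` pins of a sequence. -/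
def firstPins {n : ℕ} (p : Fin n → Pin) (m : ℕ) : Set Pin :=
  {a | ∃ k : Fin n, (k : ℕ) < m ∧ p k = a}

/-- Pin sequences. No two pins share a row or a column, and each pin `p i` after the first, with
predecessor `p j`, lies outside the bounding box of the earlier pins and either separates `p j`
from the pins before `p j` or is independent from all earlier pins. -/
structure IsPinSequence {n : ℕ} (p : Fin n → Pin) : Prop where
  distinct : ∀ i j : Fin n, i ≠ j → (p i).1 ≠ (p j).1 ∧ (p i).2 ≠ (p j).2
  outside : ∀ i j : Fin n, (i : ℕ) = j + 1 → ¬ InBoundingBox (p i) (firstPins p i)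
  step : ∀ i j : Fin n, (i : ℕ) = j + 1 →
    Separates (p i) {p j} (firstPins p j) ∨ Independent (p i) (firstPins p i)

/-- A pin representation of `σ`: a pin sequence (in any order of its points) that is order
isomorphic to the diagram `{(x, σ x)}` of `σ`. -/
structure IsPinRepresentation (σ : FinPerm) (p : Fin σ.1 → Pin) : Prop where
  pinSequence : IsPinSequence p
  orderIso : ∃ e : Equiv.Perm (Fin σ.1), ∀ i j : Fin σ.1,
    ((p i).1 < (p j).1 ↔ e i < e j) ∧ ((p i).2 < (p j).2 ↔ σ.2 (e i) < σ.2 (e j))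

/-- A proper pin representation: every pin from the third on separates its predecessor from the
pins before that. -/
structure IsProperPinRepresentation (σ : FinPerm) (p : Fin σ.1 → Pin) : Prop
    extends IsPinRepresentation σ p where
  proper : ∀ i j : Fin σ.1, (i : ℕ) = j + 1 → 0 < (j : ℕ) →
    Separates (p i) {p j} (firstPins p j)

/-- Proper pin-permutations. -/
def IsProperPinPerm (σ : FinPerm) : Prop :=
  ∃ p : Fin σ.1 → Pin, IsProperPinRepresentation σ p

/-! ### Pin words -/

/-- The directions: left, right, up, down. -/
inductive Dir : Type
  | L | R | U | D
  deriving DecidableEq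

/-- The numerals `1, 2, 3, 4`. -/
inductive Numeral : Type
  | one | two | three | four
  deriving DecidableEq

/-- The letters of pin words. -/
inductive PinLetter : Type
  | num (q : Numeral)
  | dir (d : Dir)
  deriving DecidableEq

/-- `p` lies strictly to the left of, to the right of, above, resp. below all of `S`. -/
def LiesOn (p : Pin) (S : Set Pin) : Dir → Prop
  | .L => ∀ a ∈ S, p.1 < a.1
  | .R => ∀ a ∈ S, a.1 < p.1
  | .U => ∀ a ∈ S, a.2 < p.2
  | .D => ∀ a ∈ S, p.2 < a.2

/-- `p` lies beyond the up-right, up-left, bottom-left, resp. bottom-right corner of the bounding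
box of `S`. -/
def InQuadrant (p : Pin) (S : Set Pin) : Numeral → Prop
  | .one => LiesOn p S .U ∧ LiesOn p S .R
  | .two => LiesOn p S .U ∧ LiesOn p S .L
  | .three => LiesOn p S .D ∧ LiesOn p S .L
  | .four => LiesOn p S .D ∧ LiesOn p S .R

/-- For a sequence `p 0, p 1, …, p n` with origin `p 0`, the pin `p (i + 1)` is encoded by the
given letter. A direction means that `p (i + 1)` separates `p i` from the nonempty set
`{p 0, …, p (i - 1)}` from that side; a numeral means that `p (i + 1)` is independent from
`{p 0, …, p i}` and lies in that quadrant. -/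
def IsEncodedBy {n : ℕ} (p : Fin (n + 1) → Pin) (i : Fin n) : PinLetter → Prop
  | .dir d => 0 < (i : ℕ) ∧ Separates (p i.succ) {p i.castSucc} (firstPins p i) ∧
      LiesOn (p i.succ) (firstPins p (i + 1)) d
  | .num q => Independent (p i.succ) (firstPins p (i + 1)) ∧
      InQuadrant (p i.succ) (firstPins p (i + 1)) q

/-- `w` is a pin word corresponding to `σ`: it encodes a pin representation `p 1, …, p n` of `σ`
relative to some origin `p 0` for which `p 0, p 1, …, p n` is a pin sequence. -/
def IsPinWordOf (w : List PinLetter) (σ : FinPerm) : Prop :=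
  ∃ p : Fin (σ.1 + 1) → Pin,
    IsPinSequence p ∧ IsPinRepresentation σ (fun i => p i.succ) ∧
    ∃ h : w.length = σ.1, ∀ i : Fin σ.1, IsEncodedBy p i (w.get (i.cast h.symm))

/-- A numeral followed by the directions `d u` (at least one): the shape of strict pin words. -/
def strictWord (q : Numeral) (d : Dir) (u : List Dir) : List PinLetter :=
  .num q :: .dir d :: u.map .dir

/-- Two numerals followed by the directions `u` (possibly none): the shape of quasi-strict pin
words. -/
def quasiStrictWord (k q : Numeral) (u : List Dir) : List PinLetter :=
  .num k :: .num q :: u.map .dir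

/-! ### The map `φ` and the sets `E(π)` -/

/-- The image of a two-letter strict pin word. -/
def phiTwo : Numeral → Dir → List Dir
  | .one, .R => [.R, .U, .R]
  | .one, .L => [.R, .U, .L]
  | .one, .U => [.U, .R, .U]
  | .one, .D => [.U, .R, .D]
  | .two, .R => [.L, .U, .R]
  | .two, .L => [.L, .U, .L]
  | .two, .U => [.U, .L, .U]
  | .two, .D => [.U, .L, .D]
  | .three, .R => [.L, .D, .R]
  | .three, .L => [.L, .D, .L]
  | .three, .U => [.D, .L, .U]
  | .three, .D => [.D, .L, .D]
  | .four, .R => [.R, .D, .R]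
  | .four, .L => [.R, .D, .L]
  | .four, .U => [.D, .R, .U]
  | .four, .D => [.D, .R, .D]

/-- `φ` on the strict pin word `q d u`: only the first two letters change. -/
def phi (q : Numeral) (d : Dir) (u : List Dir) : List Dir :=
  phiTwo q d ++ u

/-- The two values of `φ` on a word consisting of one numeral. -/
def phiOne : Numeral → Set (List Dir)
  | .one => {[.U, .R], [.R, .U]}
  | .two => {[.U, .L], [.L, .U]}
  | .three => {[.D, .L], [.L, .D]}
  | .four => {[.R, .D], [.D, .R]}

/-- The set of values of `φ` on a numeral followed by any number of directions. -/
def phiValues (q : Numeral) : List Dir → Set (List Dir)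
  | [] => phiOne q
  | d :: u => {phi q d u}

/-- The horizontal directions `L` and `R`. -/
def Dir.IsHorizontal : Dir → Prop
  | .L => True
  | .R => True
  | .U => False
  | .D => False

/-- The set `M` of words of length at least `3` in which horizontal and vertical directions
alternate. -/
def M : Set (List Dir) :=
  {v | 3 ≤ v.length ∧ v.IsChain (fun a b => ¬ (a.IsHorizontal ↔ b.IsHorizontal))}

/-- The two-letter words `LU, LD, RU, RD, UL, UR, DL, DR`. -/
def turns : Set (List Dir) :=
  {[.L, .U], [.L, .D], [.R, .U], [.R, .D], [.U, .L], [.U, .R], [.D, .L], [.D, .R]}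

/-- The set `E(π)` of factors associated with `π`. -/
def E (π : FinPerm) : Set (List Dir) :=
  {v | ∃ q d u, IsPinWordOf (strictWord q d u) π ∧ v = phi q d u} ∪
  {v | v ∈ M ∧ ∃ k q u, IsPinWordOf (quasiStrictWord k q u) π ∧
    ∃ x ∈ turns, ∃ t ∈ phiValues q u, v = x ++ t}

/-- The words `LL, LR, RR, RL, UU, UD, DD, DU`. -/
def nonTurns : Set (List Dir) :=
  {[.L, .L], [.L, .R], [.R, .R], [.R, .L], [.U, .U], [.U, .D], [.D, .D], [.D, .U]}

/-- The set of forbidden factors associated with `B`. -/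
def forbiddenFactors (B : Set FinPerm) : Set (List Dir) :=
  (⋃ π ∈ B, E π) ∪ nonTurns

/-- `w` has no element of `F` as a factor (contiguous subword). -/
def AvoidsFactors (F : Set (List Dir)) (w : List Dir) : Prop :=
  ∀ f ∈ F, ¬ f <:+: w

end PinPerm

/-! An alternating word of directions determines the order type of its pins. A pin with letter `b`
after a letter `a` is extreme in direction `b`, while on the axis of `a` it lies strictly between
its predecessor and all older pins; the initial pin only anchors the quadrant of the next one. This
is `Realizes`: any two realizations of a word compare alike (`Realizes.lt_iff`), and every
alternating word has one (`realizes_spiral`). A new pin cannot tell apart the pins older than its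
predecessor, so a factor of the word is realized by the pins of its letters after the first,
preceded by almost any single older pin (`Realizes.subsequence`).

A proper pin representation of size at least two realizes a word of the same length. If an element
of `E π` is a factor of that word, its realization sits inside the representation, which forces the
pattern `π` (`Realizes.isPattern_of_mem_E`). Hence members of `Av B` give avoiding words.

Conversely, realize an avoiding word and keep its initial pin as origin: the other pins form a
proper pin-permutation. Let a simple `π` occur in it. A gap after the second or a later chosen pin
would leave the pins chosen so far uncut by all the others, a nontrivial interval; so the chosen
pins are consecutive except possibly for the first (`Realizes.strictMono_eq_add`). Without a gap
they carry a strict pin word, with a gap a quasi-strict one, and an element of `E π` is a factor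
either way (`Realizes.exists_mem_E`). Since there are finitely many permutations and words of each
size, unbounded size is the same as infinitude. -/

namespace PinPerm

/-! ### Order types of finite families of pins -/

/-- The pins `p` are order isomorphic to the diagram of `σ`, in any order. -/
def Represents (σ : FinPerm) (p : Fin σ.1 → Pin) : Prop :=
  ∃ e : Equiv.Perm (Fin σ.1), ∀ i j : Fin σ.1,
    ((p i).1 < (p j).1 ↔ e i < e j) ∧ ((p i).2 < (p j).2 ↔ σ.2 (e i) < σ.2 (e j))

theorem exists_perm_lt_iff {n : ℕ} {f : Fin n → ℤ} (hf : f.Injective) :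
    ∃ e : Equiv.Perm (Fin n), ∀ i j, f i < f j ↔ e i < e j := by
  have hs : StrictMono (f ∘ Tuple.sort f) :=
    (Tuple.monotone_sort f).strictMono_of_injective (hf.comp (Tuple.sort f).injective)
  refine ⟨(Tuple.sort f)⁻¹, fun i j => ?_⟩
  rw [← hs.lt_iff_lt]
  simp

theorem exists_represents {n : ℕ} (p : Fin n → Pin)
    (h1 : (fun i => (p i).1).Injective) (h2 : (fun i => (p i).2).Injective) :
    ∃ σ : Equiv.Perm (Fin n), Represents ⟨n, σ⟩ p := by
  obtain ⟨e, he⟩ := exists_perm_lt_iff h1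
  obtain ⟨e', he'⟩ := exists_perm_lt_iff h2
  refine ⟨e⁻¹.trans e', e, fun i j => ⟨he i j, ?_⟩⟩
  simpa using he' i j

theorem Represents.isPattern {π σ : FinPerm} {p : Fin π.1 → Pin} {q : Fin σ.1 → Pin}
    (hp : Represents π p) (hq : Represents σ q) (g : Fin π.1 → Fin σ.1)
    (hg : ∀ i j, ((p i).1 < (p j).1 ↔ (q (g i)).1 < (q (g j)).1) ∧
      ((p i).2 < (p j).2 ↔ (q (g i)).2 < (q (g j)).2)) : IsPattern π σ := by
  obtain ⟨e, he⟩ := hp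
  obtain ⟨e', he'⟩ := hq
  have hmono : StrictMono (fun i => e' (g (e.symm i))) := by
    intro i j hij
    rw [← (he' _ _).1, ← (hg _ _).1, (he _ _).1]
    simpa using hij
  refine ⟨OrderEmbedding.ofStrictMono _ hmono, fun i j => ?_⟩
  have := (he (e.symm i) (e.symm j)).2
  simp only [Equiv.apply_symm_apply] at this
  rw [← this, (hg _ _).2, (he' _ _).2]
  rfl

/-- `Represents` ignores the order in which the pins are listed, so an occurrence can be sorted by
time of insertion instead of from left to right. -/
theorem IsPattern.exists_strictMono {π σ : FinPerm} {q : Fin σ.1 → Pin}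
    (h : IsPattern π σ) (hq : Represents σ q) :
    ∃ g : Fin π.1 → Fin σ.1, StrictMono g ∧ Represents π (q ∘ g) := by
  obtain ⟨f, hf⟩ := h
  obtain ⟨e, he⟩ := hq
  set k : Fin π.1 → Fin σ.1 := fun i => e.symm (f i) with hk
  have hinj : k.Injective := e.symm.injective.comp f.injective
  refine ⟨k ∘ Tuple.sort k, (Tuple.monotone_sort k).strictMono_of_injective
    (hinj.comp (Tuple.sort k).injective), Tuple.sort k, fun i j => ?_⟩
  simp only [Function.comp, (he _ _).1, (he _ _).2, hf]
  simp [hk]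

theorem exists_val_iff_of_not_cut {m k : ℕ} (e : Equiv.Perm (Fin m)) (hk : 0 < k) (hkm : k ≤ m)
    (h : ∀ a b c : Fin m, (a : ℕ) < k → (b : ℕ) < k → k ≤ (c : ℕ) → (e c < e a ↔ e c < e b)) :
    ∃ i : ℕ, i + (k - 1) < m ∧
      ∀ a : Fin m, (a : ℕ) < k ↔ i ≤ (e a : ℕ) ∧ (e a : ℕ) ≤ i + (k - 1) := by
  classical
  set T : Finset ℕ := (Finset.univ.filter fun a : Fin m => (a : ℕ) < k).image
    fun a => (e a : ℕ) with hT
  have hcard : T.card = k := by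
    rw [hT, Finset.card_image_of_injective _ (fun a b hab => e.injective (Fin.ext hab)),
      Fin.card_filter_val_lt]
    omega
  have hne : T.Nonempty := by
    rw [← Finset.card_pos, hcard]; exact hk
  have hmem : ∀ a : Fin m, (e a : ℕ) ∈ T ↔ (a : ℕ) < k := by
    intro a
    simp only [hT, Finset.mem_image, Finset.mem_filter, Finset.mem_univ, true_and]
    constructor
    · rintro ⟨b, hb, hab⟩
      rwa [← e.injective (Fin.ext hab)]
    · intro ha
      exact ⟨a, ha, rfl⟩
  have hlt : ∀ x ∈ T, x < m := by
    intro x hx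
    obtain ⟨a, -, rfl⟩ := Finset.mem_image.1 hx
    exact (e a).2
  -- A value missing from `T` between its extremes would belong to an index outside the block and
  -- would cut the two indices attaining those extremes.
  have hIcc : T = Finset.Icc (T.min' hne) (T.max' hne) := by
    ext x
    rw [Finset.mem_Icc]
    refine ⟨fun hx => ⟨T.min'_le x hx, T.le_max' x hx⟩, fun ⟨h1, h2⟩ => ?_⟩
    have hxm : x < m := h2.trans_lt (hlt _ (T.max'_mem hne))
    obtain ⟨c, hc⟩ := e.surjective ⟨x, hxm⟩
    obtain ⟨a, ha, ha'⟩ := Finset.mem_image.1 (T.min'_mem hne)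
    obtain ⟨b, hb, hb'⟩ := Finset.mem_image.1 (T.max'_mem hne)
    simp only [Finset.mem_filter, Finset.mem_univ, true_and] at ha hb
    have hx : (e c : ℕ) = x := by rw [hc]
    rw [← hx, hmem]
    by_contra hck
    have := h a b c ha hb (by omega)
    have h3 : (e c : ℕ) ≠ e a := fun h' => by
      have := e.injective (Fin.ext h'); subst this; omega
    have h4 : (e c : ℕ) ≠ e b := fun h' => by
      have := e.injective (Fin.ext h'); subst this; omega
    simp only [Fin.lt_def] at this
    omega
  have hle : T.min' hne ≤ T.max' hne := T.min'_le _ (T.max'_mem hne)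
  have hsize : T.max' hne = T.min' hne + (k - 1) := by
    have := congrArg Finset.card hIcc
    rw [hcard, Nat.card_Icc] at this
    omega
  refine ⟨T.min' hne, hsize ▸ hlt _ (T.max'_mem hne), fun a => ?_⟩
  rw [← hmem, ← hsize, ← Finset.mem_Icc, ← hIcc]

/-- In a simple permutation no proper initial family of at least two pins is left uncut by all
the other pins. -/
theorem IsSimple.exists_cut {π : FinPerm} (hπ : IsSimple π) {p : Fin π.1 → Pin}
    (hp : Represents π p) {k : ℕ} (hk : 2 ≤ k) (hkm : k < π.1)
    (h : ∀ a b c : Fin π.1, (a : ℕ) < k → (b : ℕ) < k → k ≤ (c : ℕ) →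
      ((p c).1 < (p a).1 ↔ (p c).1 < (p b).1) ∧ ((p c).2 < (p a).2 ↔ (p c).2 < (p b).2)) :
    False := by
  obtain ⟨e, he⟩ := hp
  obtain ⟨i, hi, hi'⟩ := exists_val_iff_of_not_cut e (k := k) (by omega) hkm.le
    fun a b c ha hb hc => by rw [← (he _ _).1, ← (he _ _).1]; exact (h a b c ha hb hc).1
  obtain ⟨j, hj, hj'⟩ := exists_val_iff_of_not_cut (e.trans π.2) (k := k) (by omega) hkm.le
    fun a b c ha hb hc => by
      simp only [Equiv.trans_apply]
      rw [← (he _ _).2, ← (he _ _).2]; exact (h a b c ha hb hc).2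
  -- The block fills an interval of `k` positions and one of `k` values; `2 ≤ k < π.1` rules out
  -- both trivial cases of simplicity.
  have := hπ i j (k - 1) hi hj fun a => by
    have h1 := hi' (e.symm a)
    have h2 := hj' (e.symm a)
    simp only [Equiv.trans_apply, Equiv.apply_symm_apply] at h1 h2
    rw [← h1, h2]
  omega

/-! ### Words of directions and the sequences of pins they describe -/

/-- `p` lies strictly beyond `q` in the direction `d`. -/
def Beyond : Dir → Pin → Pin → Prop
  | .L, p, q => p.1 < q.1
  | .R, p, q => q.1 < p.1
  | .U, p, q => q.2 < p.2
  | .D, p, q => p.2 < q.2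

theorem liesOn_iff {p : Pin} {S : Set Pin} {d : Dir} :
    LiesOn p S d ↔ ∀ a ∈ S, Beyond d p a := by
  cases d <;> rfl

/-- One of the two directions is horizontal and the other one is vertical. -/
def Dir.Turn (a b : Dir) : Prop := ¬ (a.IsHorizontal ↔ b.IsHorizontal)

/-- The sequence `p 0, p 1, …` is described by the word `w`: the direction of `p j` from the earlier
pins is `w j`, and `p j` separates `p (j - 1)` from the pins before it. The first letter only serves
to specify, together with the second one, the quadrant of `p 1` with respect to `p 0`. -/
structure Realizes (w : List Dir) (p : ℕ → Pin) : Prop where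
  turn : ∀ i a b, w[i]? = some a → w[i + 1]? = some b → a.Turn b
  main : ∀ i j d, i < j → w[j]? = some d → Beyond d (p j) (p i)
  far : ∀ i j d, i ≤ j → (i = 0 ∨ i < j) → j + 1 < w.length → w[j]? = some d →
    Beyond d (p (j + 1)) (p i)
  near : ∀ j d, 0 < j → j + 1 < w.length → w[j]? = some d → Beyond d (p j) (p (j + 1))

/-- `p i` followed by the pins `p (a + 1), p (a + 2), …`. -/
def subsequence (p : ℕ → Pin) (i a : ℕ) : ℕ → Pin
  | 0 => p i
  | j + 1 => p (a + 1 + j)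

/-- From `p (a + 1)` on, all pins compare in the same way with every pin before `p a`, so any of
these may anchor the factor starting at position `a`. The pin `p a` itself may not, because `p (a +
1)` stays on its near side, unless `a = 0`, where `p 1` is beyond `p 0` on both axes. -/
theorem Realizes.subsequence {w f : List Dir} {p : ℕ → Pin} (h : Realizes w p) {i a : ℕ}
    (hi : i ≤ a) (hia : i = 0 ∨ i < a) (hlen : a + f.length ≤ w.length)
    (hf : ∀ j < f.length, f[j]? = w[a + j]?) : Realizes f (subsequence p i a) := by
  have hf' : ∀ j d, f[j]? = some d → w[a + j]? = some d := fun j d hj => by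
    rw [← hf j (List.getElem?_eq_some_iff.1 hj).1, hj]
  constructor
  · intro j b c hb hc
    exact h.turn (a + j) b c (hf' _ _ hb) (hf' _ _ hc)
  · intro k j d hkj hd
    obtain ⟨j, rfl⟩ : ∃ l, j = l + 1 := ⟨j - 1, by omega⟩
    have hd := hf' _ _ hd
    rw [← add_assoc, add_right_comm] at hd
    cases k with
    | zero => exact h.main _ _ d (by omega) hd
    | succ k => exact h.main _ _ d (by omega) hd
  · intro k j d hkj hk hj hd
    have hd := hf' _ _ hd
    have e : a + 1 + j = a + j + 1 := by omega
    simp only [PinPerm.subsequence, e]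
    cases k with
    | zero => exact h.far _ _ d (by omega) (by omega) (by omega) hd
    | succ k => exact h.far _ _ d (by omega) (by omega) (by omega) hd
  · intro j d hj hj' hd
    have hd := hf' _ _ hd
    obtain ⟨j, rfl⟩ : ∃ l, j = l + 1 := ⟨j - 1, by omega⟩
    have e : a + 1 + (j + 1) = a + (j + 1) + 1 := by omega
    have e' : a + 1 + j = a + (j + 1) := by omega
    simp only [PinPerm.subsequence, e, e']
    exact h.near _ d (by omega) (by omega) hd

theorem Realizes.lt_iff_of_lt {w : List Dir} {p r : ℕ → Pin} (hp : Realizes w p)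
    (hr : Realizes w r) {i j : ℕ} (hij : i < j) (hj : j < w.length) :
    (((p i).1 < (p j).1 ↔ (r i).1 < (r j).1) ∧ ((p j).1 < (p i).1 ↔ (r j).1 < (r i).1)) ∧
    (((p i).2 < (p j).2 ↔ (r i).2 < (r j).2) ∧ ((p j).2 < (p i).2 ↔ (r j).2 < (r i).2)) := by
  obtain ⟨j, rfl⟩ : ∃ l, j = l + 1 := ⟨j - 1, by omega⟩
  obtain ⟨a, ha⟩ : ∃ a, w[j]? = some a := ⟨_, List.getElem?_eq_getElem (by omega)⟩
  obtain ⟨b, hb⟩ : ∃ b, w[j + 1]? = some b := ⟨_, List.getElem?_eq_getElem hj⟩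
  have ht := hp.turn j a b ha hb
  have h1 := hp.main i _ b hij hb
  have h2 := hr.main i _ b hij hb
  -- The last letter settles one axis; the preceding letter settles the other, with opposite
  -- outcomes for the immediate predecessor and for older pins.
  have h3 : (Beyond a (p (j + 1)) (p i) ∧ Beyond a (r (j + 1)) (r i)) ∨
      (Beyond a (p i) (p (j + 1)) ∧ Beyond a (r i) (r (j + 1))) := by
    by_cases hc : i = 0 ∨ i < j
    · exact .inl ⟨hp.far i j a (by omega) hc hj ha, hr.far i j a (by omega) hc hj ha⟩
    · obtain rfl : i = j := by omega
      exact .inr ⟨hp.near i a (by omega) hj ha, hr.near i a (by omega) hj ha⟩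
  cases a <;> cases b <;>
    simp only [Dir.Turn, Dir.IsHorizontal, Beyond, not_true_eq_false, iff_self] at ht h1 h2 h3 <;>
    omega

theorem Realizes.lt_iff {w : List Dir} {p r : ℕ → Pin} (hp : Realizes w p)
    (hr : Realizes w r) {i j : ℕ} (hi : i < w.length) (hj : j < w.length) :
    ((p i).1 < (p j).1 ↔ (r i).1 < (r j).1) ∧ ((p i).2 < (p j).2 ↔ (r i).2 < (r j).2) := by
  rcases lt_trichotomy i j with h | rfl | h
  · have := hp.lt_iff_of_lt hr h hj
    exact ⟨this.1.1, this.2.1⟩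
  · simp
  · have := hp.lt_iff_of_lt hr h hi
    exact ⟨this.1.2, this.2.2⟩

theorem Realizes.ne_of_lt {w : List Dir} {p : ℕ → Pin} (hp : Realizes w p)
    {i j : ℕ} (hij : i < j) (hj : j < w.length) : (p i).1 ≠ (p j).1 ∧ (p i).2 ≠ (p j).2 := by
  obtain ⟨j, rfl⟩ : ∃ l, j = l + 1 := ⟨j - 1, by omega⟩
  obtain ⟨a, ha⟩ : ∃ a, w[j]? = some a := ⟨_, List.getElem?_eq_getElem (by omega)⟩
  obtain ⟨b, hb⟩ : ∃ b, w[j + 1]? = some b := ⟨_, List.getElem?_eq_getElem hj⟩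
  have ht := hp.turn j a b ha hb
  have h1 := hp.main i _ b hij hb
  have h3 : Beyond a (p (j + 1)) (p i) ∨ Beyond a (p i) (p (j + 1)) := by
    by_cases hc : i = 0 ∨ i < j
    · exact .inl (hp.far i j a (by omega) hc hj ha)
    · obtain rfl : i = j := by omega
      exact .inr (hp.near i a (by omega) hj ha)
  cases a <;> cases b <;>
    simp only [Dir.Turn, Dir.IsHorizontal, Beyond, not_true_eq_false, iff_self] at ht h1 h3 <;>
    omega

theorem Realizes.ne {w : List Dir} {p : ℕ → Pin} (hp : Realizes w p)
    {i j : ℕ} (hij : i ≠ j) (hi : i < w.length) (hj : j < w.length) :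
    (p i).1 ≠ (p j).1 ∧ (p i).2 ≠ (p j).2 := by
  rcases hij.lt_or_gt with h | h
  · exact hp.ne_of_lt h hj
  · exact (hp.ne_of_lt h hi).imp Ne.symm Ne.symm

/-- A pin cuts none of the pairs of pins placed at least two steps before it. -/
theorem Realizes.not_cut {w : List Dir} {p : ℕ → Pin} (hp : Realizes w p)
    {i i' j : ℕ} (hi : i + 1 < j) (hi' : i' + 1 < j) (hj : j < w.length) :
    ((p j).1 < (p i).1 ↔ (p j).1 < (p i').1) ∧ ((p j).2 < (p i).2 ↔ (p j).2 < (p i').2) := by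
  obtain ⟨j, rfl⟩ : ∃ l, j = l + 1 := ⟨j - 1, by omega⟩
  obtain ⟨a, ha⟩ : ∃ a, w[j]? = some a := ⟨_, List.getElem?_eq_getElem (by omega)⟩
  obtain ⟨b, hb⟩ : ∃ b, w[j + 1]? = some b := ⟨_, List.getElem?_eq_getElem hj⟩
  have ht := hp.turn j a b ha hb
  have h1 := hp.main i _ b (by omega) hb
  have h2 := hp.main i' _ b (by omega) hb
  have h3 := hp.far i j a (by omega) (by omega) hj ha
  have h4 := hp.far i' j a (by omega) (by omega) hj ha
  cases a <;> cases b <;>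
    simp only [Dir.Turn, Dir.IsHorizontal, Beyond, not_true_eq_false, iff_self]
      at ht h1 h2 h3 h4 <;> omega

/-! ### Every alternating word is realized -/

/-- The point with the coordinate `x` in the direction `a` and `y` in the direction `b`. -/
def place : Dir → Dir → ℤ → ℤ → Pin
  | .L, .U, x, y => (-x, y)
  | .L, .D, x, y => (-x, -y)
  | .R, .U, x, y => (x, y)
  | .R, .D, x, y => (x, -y)
  | .U, .L, x, y => (-y, x)
  | .U, .R, x, y => (y, x)
  | .D, .L, x, y => (-y, -x)
  | .D, .R, x, y => (y, -x)
  | _, _, _, _ => (0, 0)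

/-- The coordinates of a sequence of pins realizing an alternating word. -/
def spiral (w : List Dir) (j : ℕ) : Pin :=
  place (w.getD (j - 1) .U) (w.getD j .U) |2 * j - 3| (2 * j)

theorem abs_spiral_le (w : List Dir) (j : ℕ) :
    |(spiral w j).1| ≤ 2 * j ∧ |(spiral w j).2| ≤ 2 * j := by
  rcases Nat.eq_zero_or_pos j with rfl | hj
  · rw [spiral]
    cases w.getD (0 - 1) .U <;> simp [place]
  · have h1 : |(2 * j - 3 : ℤ)| ≤ 2 * j := by rw [abs_le]; omega
    -- Truncated subtraction makes the two letters equal at index `0`, so `place` takes its default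
    -- value, the point `(0, 0)`.
    rw [spiral]
    have h2 := abs_nonneg (2 * j - 3 : ℤ)
    generalize |(2 * j - 3 : ℤ)| = x at *
    cases w.getD (j - 1) .U <;> cases w.getD j .U <;> simp only [place, abs_le] <;> omega

theorem beyond_place {a b : Dir} (h : a.Turn b) {x y : ℤ} {q : Pin} :
    (|q.1| < y → |q.2| < y → Beyond b (place a b x y) q) ∧
    (|q.1| < x → |q.2| < x → Beyond a (place a b x y) q) := by
  simp only [abs_lt]
  cases a <;> cases b <;>
    simp only [Dir.Turn, Dir.IsHorizontal, Beyond, place, not_true_eq_false, iff_self] at h ⊢ <;>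
    omega

theorem beyond_place_place {a b c : Dir} (h : a.Turn b) (h' : b.Turn c) {x y x' y' : ℤ}
    (hxy : x' < y) : Beyond b (place a b x y) (place b c x' y') := by
  cases a <;> cases b <;>
    simp only [Dir.Turn, Dir.IsHorizontal, not_true_eq_false, iff_self] at h <;>
    cases c <;>
    simp only [Dir.Turn, Dir.IsHorizontal, Beyond, place, not_true_eq_false, iff_self] at h' ⊢ <;>
    omega

/-- Earlier pins have coordinates of size at most `2 * j - 2`, so `2 * j` is extreme. On the other
axis `2 * j - 3` falls between the predecessor's `2 * j - 2` and the bound `2 * j - 4` for older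
pins. The absolute value matters only for `j ≤ 1`: it puts `p 1` in the quadrant of the first two
letters. -/
theorem realizes_spiral {w : List Dir}
    (hw : ∀ i a b, w[i]? = some a → w[i + 1]? = some b → a.Turn b) : Realizes w (spiral w) := by
  have key : ∀ j, j + 1 < w.length → ∃ a b, w[j]? = some a ∧ w[j + 1]? = some b ∧ a.Turn b ∧
      spiral w (j + 1) = place a b |2 * (j + 1 : ℕ) - 3| (2 * (j + 1 : ℕ)) := by
    intro j hj
    have ha := List.getElem?_eq_getElem (l := w) (i := j) (by omega)
    have hb := List.getElem?_eq_getElem hj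
    refine ⟨_, _, ha, hb, hw _ _ _ ha hb, ?_⟩
    rw [spiral, Nat.add_sub_cancel, List.getD_eq_getElem?_getD, List.getD_eq_getElem?_getD, ha, hb]
    rfl
  refine ⟨hw, fun i j d hij hd => ?_, fun i j d hij hij' hj hd => ?_, fun j d hj hj' hd => ?_⟩
  · obtain ⟨j, rfl⟩ : ∃ l, j = l + 1 := ⟨j - 1, by omega⟩
    obtain ⟨a, b, ha, hb, hab, h⟩ := key j (List.getElem?_eq_some_iff.1 hd).1
    obtain rfl : b = d := by simpa [hb] using hd
    rw [h]
    have := abs_spiral_le w i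
    exact (beyond_place hab).1 (by omega) (by omega)
  · obtain ⟨a, b, ha, hb, hab, h⟩ := key j hj
    obtain rfl : a = d := by simpa [ha] using hd
    rw [h]
    have := abs_spiral_le w i
    have h1 := le_abs_self (2 * (j + 1 : ℕ) - 3 : ℤ)
    have h2 := neg_le_abs (2 * (j + 1 : ℕ) - 3 : ℤ)
    exact (beyond_place hab).2 (by omega) (by omega)
  · obtain ⟨a, b, ha, hb, hab, h⟩ := key j hj'
    obtain ⟨j, rfl⟩ : ∃ l, j = l + 1 := ⟨j - 1, by omega⟩
    obtain ⟨c, a', hc, ha', hca, h'⟩ := key j (by omega)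
    obtain rfl : a = d := by simpa [ha] using hd
    obtain rfl : a = a' := by simpa [ha] using ha'
    rw [h, h']
    refine beyond_place_place hca hab ?_
    rw [abs_lt]
    omega

/-! ### Pin words and words of directions -/

/-- A uniform description of `φ`: the numeral becomes its two directions, in the order that makes
the second one turn into the next letter. With no next letter both orders remain. -/
theorem mem_phiValues {q : Numeral} {u t : List Dir} :
    t ∈ phiValues q u ↔ ∃ a b, [a, b] ∈ phiOne q ∧ (∀ d ∈ u.head?, b.Turn d) ∧
      t = a :: b :: u := by
  cases u with
  | nil =>
    constructor
    · intro h
      cases q <;> simp only [phiValues, phiOne, Set.mem_insert_iff, Set.mem_singleton_iff] at h <;>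
        rcases h with rfl | rfl <;> simp [phiOne]
    · rintro ⟨a, b, h, -, rfl⟩
      exact h
  | cons d u =>
    constructor
    · rintro rfl
      cases q <;> cases d <;> simp [phi, phiTwo, phiOne, Dir.Turn, Dir.IsHorizontal]
    · rintro ⟨a, b, h, h', rfl⟩
      cases q <;> cases d <;> cases a <;> cases b <;>
        simp_all [phi, phiTwo, phiOne, Dir.Turn, Dir.IsHorizontal, phiValues]

theorem turn_of_mem_phiOne {q : Numeral} {a b : Dir} (h : [a, b] ∈ phiOne q) : a.Turn b := by
  cases q <;> cases a <;> cases b <;> simp_all [phiOne, Dir.Turn, Dir.IsHorizontal]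

theorem exists_mem_phiOne {a b : Dir} (h : a.Turn b) : ∃ q, [a, b] ∈ phiOne q := by
  have : [a, b] ∈ phiOne .one ∨ [a, b] ∈ phiOne .two ∨ [a, b] ∈ phiOne .three ∨
      [a, b] ∈ phiOne .four := by
    cases a <;> cases b <;> simp_all [phiOne, Dir.Turn, Dir.IsHorizontal]
  rcases this with h | h | h | h <;> exact ⟨_, h⟩

theorem inQuadrant_iff {q : Numeral} {a b : Dir} (h : [a, b] ∈ phiOne q) {p : Pin} {S : Set Pin} :
    InQuadrant p S q ↔ ∀ s ∈ S, Beyond a p s ∧ Beyond b p s := by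
  cases q <;> simp only [phiOne, Set.mem_insert_iff, Set.mem_singleton_iff, List.cons.injEq,
    and_true] at h <;> rcases h with ⟨rfl, rfl⟩ | ⟨rfl, rfl⟩ <;>
    simp only [InQuadrant, LiesOn, Beyond, ← forall₂_and] <;>
    first | rfl | simp only [and_comm]

theorem InQuadrant.independent {p : Pin} {S : Set Pin} {q : Numeral} (h : InQuadrant p S q) :
    Independent p S := by
  rintro ⟨P, Q, ⟨a, ha⟩, ⟨b, hb⟩, rfl, hs⟩
  cases q <;> (
    simp only [InQuadrant, LiesOn] at h
    have h1 := h.1 a (.inl ha)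
    have h2 := h.2 a (.inl ha)
    have h3 := h.1 b (.inr hb)
    have h4 := h.2 b (.inr hb)
    rcases hs with (⟨h5, h6⟩ | ⟨h5, h6⟩) | (⟨h5, h6⟩ | ⟨h5, h6⟩) <;>
    · have h5 := h5 a ha
      have h6 := h6 b hb
      omega)

theorem exists_inQuadrant {p q : Pin} (h1 : p.1 ≠ q.1) (h2 : p.2 ≠ q.2) :
    ∃ k, InQuadrant p {q} k := by
  have : InQuadrant p {q} .one ∨ InQuadrant p {q} .two ∨ InQuadrant p {q} .three ∨
      InQuadrant p {q} .four := by
    simp only [InQuadrant, LiesOn, Set.mem_singleton_iff, forall_eq]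
    omega
  rcases this with h | h | h | h <;> exact ⟨_, h⟩

theorem separates_of_beyond {p x : Pin} {S : Set Pin} {b : Dir} (hS : ∀ s ∈ S, Beyond b p s)
    (hx : Beyond b x p) : Separates p {x} S := by
  cases b
  · exact .inl (.inl ⟨by rintro _ rfl; exact hx, hS⟩)
  · exact .inl (.inr ⟨by rintro _ rfl; exact hx, hS⟩)
  · exact .inr (.inr ⟨by rintro _ rfl; exact hx, hS⟩)
  · exact .inr (.inl ⟨by rintro _ rfl; exact hx, hS⟩)

theorem LiesOn.not_inBoundingBox {p : Pin} {S : Set Pin} {d : Dir} (h : LiesOn p S d) :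
    ¬ InBoundingBox p S := by
  rintro ⟨⟨⟨a, ha, ha'⟩, b, hb, hb'⟩, ⟨c, hc, hc'⟩, e, he, he'⟩
  cases d
  · exact (h a ha).not_ge ha'
  · exact (h b hb).not_ge hb'
  · exact (h e he).not_ge he'
  · exact (h c hc).not_ge hc'

theorem InQuadrant.exists_liesOn {p : Pin} {S : Set Pin} {q : Numeral} (h : InQuadrant p S q) :
    ∃ d, LiesOn p S d := by
  cases q <;> exact ⟨_, h.1⟩

theorem LiesOn.mono {p : Pin} {S T : Set Pin} {d : Dir} (h : LiesOn p S d) (hT : T ⊆ S) :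
    LiesOn p T d :=
  liesOn_iff.2 fun a ha => liesOn_iff.1 h a (hT ha)

theorem InQuadrant.mono {p : Pin} {S T : Set Pin} {q : Numeral} (h : InQuadrant p S q)
    (hT : T ⊆ S) : InQuadrant p T q := by
  cases q <;> exact ⟨h.1.mono hT, h.2.mono hT⟩

theorem Separates.mono {p : Pin} {P Q Q' : Set Pin} (h : Separates p P Q) (hQ : Q' ⊆ Q) :
    Separates p P Q' :=
  h.imp (Or.imp (And.imp_right fun h b hb => h b (hQ hb))
      (And.imp_right fun h b hb => h b (hQ hb)))
    (Or.imp (And.imp_right fun h b hb => h b (hQ hb))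
      (And.imp_right fun h b hb => h b (hQ hb)))

/-- A sequence of pins in general position, each of which is encoded by a letter, gives a pin
word. -/
theorem isPinWordOf_of_isEncodedBy {π : FinPerm} {p : Fin (π.1 + 1) → Pin} {w : List PinLetter}
    (hw : w.length = π.1)
    (hne : ∀ i j, i ≠ j → (p i).1 ≠ (p j).1 ∧ (p i).2 ≠ (p j).2)
    (hrep : Represents π fun i => p i.succ)
    (henc : ∀ i : Fin π.1, IsEncodedBy p i (w.get (i.cast hw.symm))) :
    IsPinWordOf w π := by
  have hsub : ∀ m, firstPins (fun i : Fin π.1 => p i.succ) m ⊆ firstPins p (m + 1) := by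
    rintro m _ ⟨k, hk, rfl⟩
    exact ⟨k.succ, by simpa using hk, rfl⟩
  have hout : ∀ i : Fin π.1, ∃ d, LiesOn (p i.succ) (firstPins p (i + 1)) d := by
    intro i
    have := henc i
    cases hl : w.get (i.cast hw.symm) with
    | num q => rw [hl] at this; exact this.2.exists_liesOn
    | dir d => rw [hl] at this; exact ⟨d, this.2.2⟩
  have hstep : ∀ i : Fin π.1, Separates (p i.succ) {p i.castSucc} (firstPins p i) ∨
      ∃ q, InQuadrant (p i.succ) (firstPins p (i + 1)) q := by
    intro i
    have := henc i
    cases hl : w.get (i.cast hw.symm) with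
    | num q => rw [hl] at this; exact .inr ⟨q, this.2⟩
    | dir d => rw [hl] at this; exact .inl this.2.1
  refine ⟨p, ⟨hne, ?_, ?_⟩, ⟨⟨fun i j hij => hne _ _ (by simpa using hij), ?_, ?_⟩, hrep⟩,
    hw, henc⟩
  · intro i j hij
    obtain ⟨i, rfl⟩ : ∃ l : Fin π.1, i = l.succ := ⟨i.pred (by rintro rfl; simp at hij), by simp⟩
    obtain ⟨d, hd⟩ := hout i
    exact hd.not_inBoundingBox
  · intro i j hij
    obtain ⟨i, rfl⟩ : ∃ l : Fin π.1, i = l.succ := ⟨i.pred (by rintro rfl; simp at hij), by simp⟩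
    obtain rfl : j = i.castSucc := by ext; simpa using hij.symm
    exact (hstep i).imp id fun ⟨q, hq⟩ => hq.independent
  · intro i j hij
    obtain ⟨d, hd⟩ := hout i
    exact (hd.mono (hsub _)).not_inBoundingBox
  · intro i j hij
    obtain hj : j.succ = i.castSucc := by ext; simpa using hij.symm
    rw [hj]
    refine (hstep i).imp (fun h => h.mono ?_) fun ⟨q, hq⟩ => (hq.mono (hsub _)).independent
    rw [hij]
    exact hsub _

/-- Being extreme in direction `d`, the pin `p` cannot separate along that axis, so it separates
along the axis of `c`, where `x` is the extreme point. -/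
theorem Separates.beyond {p x : Pin} {S : Set Pin} {c d : Dir} (h : Separates p {x} S)
    (hcd : c.Turn d) (hx : ∀ s ∈ S, Beyond c x s) (hp : ∀ s ∈ S, Beyond d p s)
    (hpx : Beyond d p x) {s : Pin} (hs : s ∈ S) : Beyond c p s ∧ Beyond c x p := by
  have h1 := hx s hs
  have h2 := hp s hs
  rcases h with (⟨h3, h4⟩ | ⟨h3, h4⟩) | (⟨h3, h4⟩ | ⟨h3, h4⟩) <;>
  · have h3 := h3 x rfl
    have h4 := h4 s hs
    cases c <;> cases d <;>
      simp only [Dir.Turn, Dir.IsHorizontal, Beyond, not_true_eq_false, iff_self]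
        at hcd h1 h2 hpx ⊢ <;> omega

/-- If the axes differed, neither could separate: along `d` the pin is extreme, and along `c` the
point `x` is sandwiched between two points of `S`. This is what forces directions to alternate. -/
theorem Separates.turn {p x s s' : Pin} {S : Set Pin} {c d : Dir} (h : Separates p {x} S)
    (hs : s ∈ S) (hs' : s' ∈ S) (h1 : Beyond c x s) (h2 : Beyond c s' x)
    (hps : Beyond d p s) (hps' : Beyond d p s') (hpx : Beyond d p x) : ¬ c.Turn d := by
  intro hcd
  rcases h with (⟨h3, h4⟩ | ⟨h3, h4⟩) | (⟨h3, h4⟩ | ⟨h3, h4⟩) <;>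
  · have h3 := h3 x rfl
    have h5 := h4 s hs
    have h6 := h4 s' hs'
    cases c <;> cases d <;>
      simp only [Dir.Turn, Dir.IsHorizontal, Beyond, not_true_eq_false, iff_self]
        at hcd h1 h2 hps hps' hpx <;> omega

theorem Dir.Turn.of_not {a b c : Dir} (h : a.Turn b) (h' : ¬ a.Turn c) : b.Turn c := by
  unfold Dir.Turn at *
  tauto

/-- A sequence that starts in the quadrant `q` and in which each later pin separates its predecessor
from the earlier pins, in the directions `u`, realizes the words `φ (q u)`. -/
theorem realizes_of_separates {p : ℕ → Pin} {q : Numeral} {u t : List Dir}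
    (hq : InQuadrant (p 1) {p 0} q)
    (hu : ∀ i d, u[i]? = some d → (∀ j ≤ i + 1, Beyond d (p (i + 2)) (p j)) ∧
      Separates (p (i + 2)) {p (i + 1)} {a | ∃ k ≤ i, p k = a})
    (ht : t ∈ phiValues q u) : Realizes t p := by
  obtain ⟨a, b, hab, hbu, rfl⟩ := mem_phiValues.1 ht
  have hq := (inQuadrant_iff hab).1 hq (p 0) rfl
  have hmain : ∀ i j d, i < j → (a :: b :: u)[j]? = some d → Beyond d (p j) (p i) := by
    intro i j d hij hd
    match j with
    | 1 =>
      obtain rfl : b = d := by simpa using hd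
      obtain rfl : i = 0 := by omega
      exact hq.2
    | j + 2 => exact (hu j d (by simpa using hd)).1 i (by omega)
  have hstep : ∀ i c d, (a :: b :: u)[i + 1]? = some c → (a :: b :: u)[i + 2]? = some d →
      c.Turn d ∧ (∀ k ≤ i, Beyond c (p (i + 2)) (p k)) ∧ Beyond c (p (i + 1)) (p (i + 2)) := by
    intro i
    induction i with
    | zero =>
      intro c d hc hd
      obtain rfl : b = c := by simpa using hc
      have hd' : u[0]? = some d := by simpa using hd
      -- No earlier separation forces the first turn; the order of the two letters chosen by `φ`
      -- provides it.
      have hbd : b.Turn d := hbu d (by simpa [List.head?_eq_getElem?] using hd')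
      obtain ⟨h1, h2⟩ := hu 0 d hd'
      have h3 : ∀ k ≤ 0, Beyond b (p 2) (p k) ∧ Beyond b (p 1) (p 2) := fun k hk =>
        h2.beyond hbd (by rintro _ ⟨k, hk, rfl⟩; obtain rfl : k = 0 := (by omega); exact hq.2)
          (by rintro _ ⟨k, hk, rfl⟩; exact h1 k (by omega)) (h1 1 le_rfl) ⟨k, hk, rfl⟩
      exact ⟨hbd, fun k hk => (h3 k hk).1, (h3 0 le_rfl).2⟩
    | succ i ih =>
      intro c d hc hd
      obtain ⟨c', hc'⟩ : ∃ c', (a :: b :: u)[i + 1]? = some c' :=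
        ⟨_, List.getElem?_eq_getElem (by
          have := (List.getElem?_eq_some_iff.1 hc).1
          omega)⟩
      obtain ⟨hturn, hfar, hnear⟩ := ih c' c hc' hc
      obtain ⟨h1, h2⟩ := hu (i + 1) d (by simpa using hd)
      -- On the axis of `c'` the predecessor is sandwiched between `p 0` and `p (i + 1)`, so the new
      -- direction must lie on that same axis, hence off the axis of `c`.
      have hcd : c.Turn d := hturn.of_not <| h2.turn ⟨0, by omega, rfl⟩ ⟨i + 1, le_rfl, rfl⟩
        (hfar 0 (by omega)) hnear (h1 _ (by omega)) (h1 _ (by omega)) (h1 _ le_rfl)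
      have h3 : ∀ k ≤ i + 1, Beyond c (p (i + 3)) (p k) ∧ Beyond c (p (i + 2)) (p (i + 3)) :=
        fun k hk => h2.beyond hcd
          (by rintro _ ⟨k, hk, rfl⟩; exact hmain _ _ _ (by omega) hc)
          (by rintro _ ⟨k, hk, rfl⟩; exact h1 k (by omega)) (h1 _ le_rfl) ⟨k, hk, rfl⟩
      exact ⟨hcd, fun k hk => (h3 k hk).1, (h3 0 (by omega)).2⟩
  refine ⟨fun i c d hc hd => ?_, hmain, fun i j c hij hij' hj hc => ?_, fun j c hj hj' hc => ?_⟩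
  · cases i with
    | zero =>
      obtain rfl : a = c := by simpa using hc
      obtain rfl : b = d := by simpa using hd
      exact turn_of_mem_phiOne hab
    | succ i => exact (hstep i c d hc hd).1
  · cases j with
    | zero =>
      obtain rfl : a = c := by simpa using hc
      obtain rfl : i = 0 := by omega
      exact hq.1
    | succ j => exact (hstep j c _ hc (List.getElem?_eq_getElem hj)).2.1 i (by omega)
  · obtain ⟨j, rfl⟩ : ∃ l, j = l + 1 := ⟨j - 1, by omega⟩
    exact (hstep j c _ hc (List.getElem?_eq_getElem hj')).2.2

theorem Realizes.inQuadrant {p : ℕ → Pin} {q : Numeral} {a b : Dir} {u : List Dir}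
    (h : Realizes (a :: b :: u) p) (hq : [a, b] ∈ phiOne q) : InQuadrant (p 1) {p 0} q := by
  rw [inQuadrant_iff hq]
  rintro _ rfl
  exact ⟨h.far 0 0 a le_rfl (.inl rfl) (by simp) rfl, h.main 0 1 b (by simp) rfl⟩

theorem Realizes.beyond_letter {p : ℕ → Pin} {a b d : Dir} {u : List Dir}
    (h : Realizes (a :: b :: u) p) {i j : ℕ} (hd : u[i]? = some d) (hj : j ≤ i + 1) :
    Beyond d (p (i + 2)) (p j) :=
  h.main _ _ d (by omega) (by simpa using hd)

theorem Realizes.exists_beyond {p : ℕ → Pin} {a b : Dir} {u : List Dir}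
    (h : Realizes (a :: b :: u) p) {i : ℕ} (hi : i < u.length) :
    ∃ c, (b :: u)[i]? = some c ∧ (∀ k ≤ i, Beyond c (p (i + 2)) (p k)) ∧
      Beyond c (p (i + 1)) (p (i + 2)) := by
  have hc := List.getElem?_eq_getElem (l := b :: u) (i := i) (by simp; omega)
  exact ⟨_, hc, fun k hk => h.far k (i + 1) _ (by omega) (by omega) (by simp; omega) hc,
    h.near (i + 1) _ (by omega) (by simp; omega) hc⟩

/-- The strict pin word of a permutation represented by all but the first of the pins of a
sequence. -/
theorem Realizes.isPinWordOf_strictWord {π : FinPerm} {p : ℕ → Pin} {q : Numeral} {a b d : Dir}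
    {u : List Dir} (h : Realizes (a :: b :: d :: u) p) (hq : [a, b] ∈ phiOne q)
    (hlen : u.length + 2 = π.1) (hrep : Represents π fun i => p (i + 1)) :
    IsPinWordOf (strictWord q d u) π := by
  refine isPinWordOf_of_isEncodedBy (p := fun i => p i) (by simpa [strictWord] using hlen)
    (fun i j hij => h.ne (by omega) (by simp; omega) (by simp; omega)) (by simpa using hrep) ?_
  rintro ⟨i, hi⟩
  simp only [List.get_eq_getElem, Fin.val_cast]
  match i with
  | 0 =>
    have hS : firstPins (fun i : Fin (π.1 + 1) => p i) 1 ⊆ {p 0} := by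
      rintro _ ⟨k, hk, rfl⟩
      simp only [Set.mem_singleton_iff]
      congr 1
      omega
    have := (h.inQuadrant hq).mono hS
    exact ⟨this.independent, this⟩
  | i + 1 =>
    have hi' : i < (d :: u).length := by simp; omega
    have hl : (strictWord q d u)[i + 1]'(by simp [strictWord]; omega) = .dir ((d :: u)[i]) := by
      cases i <;> simp [strictWord]
    rw [hl]
    obtain ⟨c, -, h1, h2⟩ := h.exists_beyond hi'
    refine ⟨Nat.succ_pos i, separates_of_beyond ?_ h2, liesOn_iff.2 ?_⟩
    · rintro _ ⟨k, hk, rfl⟩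
      exact h1 k (Nat.lt_succ_iff.1 hk)
    · rintro _ ⟨k, hk, rfl⟩
      exact h.beyond_letter (List.getElem?_eq_getElem hi') (Nat.lt_succ_iff.1 hk)

/-- The quasi-strict pin words of a permutation represented by all pins of a sequence, the first of
which may be replaced by the origin. -/
theorem Realizes.exists_isPinWordOf_quasiStrictWord {π : FinPerm} {p p' : ℕ → Pin} {q : Numeral}
    {a b : Dir} {u : List Dir} (h : Realizes (a :: b :: u) p) (h' : Realizes (a :: b :: u) p')
    (hpp' : ∀ i, p (i + 1) = p' (i + 1)) (h1 : (p 0).1 ≠ (p' 0).1) (h2 : (p 0).2 ≠ (p' 0).2)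
    (hq : [a, b] ∈ phiOne q) (hlen : u.length + 2 = π.1) (hrep : Represents π fun i => p i) :
    ∃ k, IsPinWordOf (quasiStrictWord k q u) π := by
  obtain ⟨k, hk⟩ := exists_inQuadrant h1 h2
  -- The anchor of the second realization serves as origin; `p 0` comes next, in the quadrant `k`,
  -- and all later pins are shared.
  set r : Fin (π.1 + 1) → Pin := Fin.cons (p' 0) fun i => p i with hr
  have hr' : ∀ m, ∀ s ∈ firstPins r (m + 1), s = p' 0 ∨ ∃ j < m, s = p j := by
    rintro m _ ⟨j, hj, rfl⟩
    cases j using Fin.cases with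
    | zero => exact .inl rfl
    | succ j => exact .inr ⟨j, by simpa using hj, rfl⟩
  have hne : ∀ i : Fin π.1, (p i).1 ≠ (p' 0).1 ∧ (p i).2 ≠ (p' 0).2 := by
    rintro ⟨i, hi⟩
    match i with
    | 0 => exact ⟨h1, h2⟩
    | i + 1 =>
      simp only [hpp']
      exact h'.ne (by omega) (by simp; omega) (by simp)
  refine ⟨k, isPinWordOf_of_isEncodedBy (p := r) (by simpa [quasiStrictWord] using hlen)
    (fun i j hij => ?_) (by simpa [hr] using hrep) ?_⟩
  · cases i using Fin.cases with
    | zero =>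
      cases j using Fin.cases with
      | zero => exact absurd rfl hij
      | succ j => exact (hne j).imp Ne.symm Ne.symm
    | succ i =>
      cases j using Fin.cases with
      | zero => exact hne i
      | succ j =>
        have hij' : i ≠ j := fun h => hij (by rw [h])
        exact h.ne (Fin.val_ne_of_ne hij') (by simp; omega) (by simp; omega)
  rintro ⟨i, hi⟩
  simp only [List.get_eq_getElem, Fin.val_cast]
  match i with
  | 0 =>
    have hS : firstPins r 1 ⊆ {p' 0} := fun s hs => by
      rcases hr' 0 s hs with hs | ⟨j, hj, -⟩
      · exact hs
      · omega
    have := hk.mono hS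
    exact ⟨this.independent, this⟩
  | 1 =>
    have : InQuadrant (p 1) (firstPins r 2) q := by
      rw [inQuadrant_iff hq]
      intro s hs
      rcases hr' 1 s hs with rfl | ⟨j, hj, rfl⟩
      · rw [hpp' 0]
        exact (inQuadrant_iff hq).1 (h'.inQuadrant hq) _ rfl
      · obtain rfl : j = 0 := by omega
        exact (inQuadrant_iff hq).1 (h.inQuadrant hq) _ rfl
    exact ⟨this.independent, this⟩
  | i + 2 =>
    have hi' : i < u.length := by omega
    have hl : (quasiStrictWord k q u)[i + 2]'(by simp [quasiStrictWord]; omega) = .dir u[i] := by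
      simp [quasiStrictWord]
    rw [hl]
    obtain ⟨c, hc, h3, h4⟩ := h.exists_beyond hi'
    obtain ⟨c', hc', h3', -⟩ := h'.exists_beyond hi'
    obtain rfl : c = c' := by simpa [hc] using hc'
    refine ⟨Nat.succ_pos _, separates_of_beyond (b := c) ?_ h4, liesOn_iff.2 ?_⟩
    · intro s hs
      rcases hr' (i + 1) s hs with rfl | ⟨j, hj, rfl⟩
      · change Beyond _ (p (i + 2)) _
        rw [hpp' (i + 1)]
        exact h3' 0 (by omega)
      · exact h3 j (by omega)
    · intro s hs
      have hd := List.getElem?_eq_getElem hi'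
      rcases hr' (i + 2) s hs with rfl | ⟨j, hj, rfl⟩
      · change Beyond _ (p (i + 2)) _
        rw [hpp' (i + 1)]
        exact h'.beyond_letter hd (by omega)
      · exact h.beyond_letter hd (by omega)

/-- The extension of a finite sequence of pins by the pin `0`. -/
def extend {n : ℕ} (p : Fin n → Pin) (i : ℕ) : Pin :=
  if h : i < n then p ⟨i, h⟩ else 0

theorem extend_val {n : ℕ} (p : Fin n → Pin) (i : Fin n) : extend p i = p i := by
  simp [extend]

theorem extend_of_lt {n : ℕ} (p : Fin n → Pin) {i : ℕ} (h : i < n) : extend p i = p ⟨i, h⟩ := by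
  simp [extend, h]

theorem extend_mem_firstPins {n : ℕ} (p : Fin n → Pin) {i m : ℕ} (h : i < n) (hm : i < m) :
    extend p i ∈ firstPins p m :=
  ⟨⟨i, h⟩, hm, (extend_of_lt p h).symm⟩

/-! ### From pin words and proper representations to realized words. -/

theorem exists_mem_phiValues (q : Numeral) (u : List Dir) : ∃ t, t ∈ phiValues q u := by
  cases u with
  | nil => cases q <;> exact ⟨_, .inl rfl⟩
  | cons d u => exact ⟨_, rfl⟩

theorem length_of_mem_phiValues {q : Numeral} {u t : List Dir} (h : t ∈ phiValues q u) :
    t.length = u.length + 2 := by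
  obtain ⟨a, b, -, -, rfl⟩ := mem_phiValues.1 h
  rfl

theorem isEncodedBy_dir {n : ℕ} {p : Fin (n + 1) → Pin} {i : ℕ} (hi : i < n) {d : Dir}
    (h : IsEncodedBy p ⟨i, hi⟩ (.dir d)) : (∀ j ≤ i, Beyond d (extend p (i + 1)) (extend p j)) ∧
      Separates (extend p (i + 1)) {extend p i} {a | ∃ k < i, extend p k = a} := by
  obtain ⟨-, h1, h2⟩ := h
  rw [extend_of_lt p (i := i + 1) (by omega), extend_of_lt p (i := i) (by omega)]
  refine ⟨fun j hj => liesOn_iff.1 h2 _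
    (extend_mem_firstPins p (by omega) (Nat.lt_succ_of_le hj)), h1.mono ?_⟩
  rintro _ ⟨k, hk, rfl⟩
  exact extend_mem_firstPins p (by omega) hk

theorem IsPinWordOf.exists_realizes_of_strictWord {π : FinPerm} {q : Numeral} {d : Dir}
    {u : List Dir} (h : IsPinWordOf (strictWord q d u) π) :
    (phi q d u).length = π.1 + 1 ∧
      ∃ p, Realizes (phi q d u) p ∧ Represents π fun i => p (i + 1) := by
  obtain ⟨p, -, hrep, hlen, henc⟩ := h
  have ht : phi q d u ∈ phiValues q (d :: u) := rfl
  have hlen' : u.length + 2 = π.1 := by simpa [strictWord] using hlen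
  refine ⟨by simpa [← hlen'] using length_of_mem_phiValues ht, extend p,
    realizes_of_separates (q := q) ?_ (fun i c hc => ?_) ht, ?_⟩
  · have := (henc ⟨0, by omega⟩).2
    rw [extend_of_lt p (by omega), extend_of_lt p (i := 0) (by omega)]
    refine InQuadrant.mono this ?_
    rintro _ rfl
    exact ⟨0, Nat.zero_lt_one, rfl⟩
  · obtain ⟨hi, rfl⟩ := List.getElem?_eq_some_iff.1 hc
    simp only [List.length_cons] at hi
    have hl := henc ⟨i + 1, by omega⟩
    have : (strictWord q d u)[i + 1]'(by simp [strictWord]; omega) = .dir ((d :: u)[i]) := by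
      cases i <;> simp [strictWord]
    simp only [List.get_eq_getElem, Fin.val_cast, this] at hl
    simpa only [Nat.lt_succ_iff] using isEncodedBy_dir _ hl
  · obtain ⟨e, he⟩ := hrep.orderIso
    have hval : ∀ i : Fin π.1, extend p (i + 1) = p i.succ := fun i => extend_val p i.succ
    exact ⟨e, fun i j => by simpa only [hval] using he i j⟩

theorem IsPinWordOf.exists_realizes_of_quasiStrictWord {π : FinPerm} {k q : Numeral}
    {u t : List Dir} (h : IsPinWordOf (quasiStrictWord k q u) π) (ht : t ∈ phiValues q u) :
    t.length = π.1 ∧ ∃ p, Realizes t p ∧ Represents π fun i => p i := by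
  obtain ⟨p, -, hrep, hlen, henc⟩ := h
  have hlen' : u.length + 2 = π.1 := by simpa [quasiStrictWord] using hlen
  refine ⟨by simpa [← hlen'] using length_of_mem_phiValues ht, fun i => extend p (i + 1),
    realizes_of_separates (q := q) ?_ (fun i c hc => ?_) ht, ?_⟩
  · have := (henc ⟨1, by omega⟩).2
    simp only [extend_of_lt p (i := 1) (by omega), extend_of_lt p (i := 2) (by omega)]
    refine InQuadrant.mono this ?_
    rintro _ rfl
    exact ⟨⟨1, by omega⟩, Nat.one_lt_two, rfl⟩
  · obtain ⟨hi, rfl⟩ := List.getElem?_eq_some_iff.1 hc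
    have hl := henc ⟨i + 2, by omega⟩
    have : (quasiStrictWord k q u)[i + 2]'(by simp [quasiStrictWord]; omega) = .dir u[i] := by
      simp [quasiStrictWord]
    simp only [List.get_eq_getElem, Fin.val_cast, this] at hl
    obtain ⟨h1, h2⟩ := isEncodedBy_dir _ hl
    refine ⟨fun j hj => h1 _ (by omega), h2.mono ?_⟩
    rintro _ ⟨j, hj, rfl⟩
    exact ⟨j + 1, by omega, rfl⟩
  · obtain ⟨e, he⟩ := hrep.orderIso
    have hval : ∀ i : Fin π.1, extend p (i + 1) = p i.succ := fun i => extend_val p i.succ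
    exact ⟨e, fun i j => by simpa only [hval] using he i j⟩

theorem exists_liesOn_of_not_inBoundingBox {p : Pin} {S : Set Pin} (h : ¬ InBoundingBox p S) :
    ∃ d, LiesOn p S d := by
  by_contra! h'
  have h1 := h' .L
  have h2 := h' .R
  have h3 := h' .U
  have h4 := h' .D
  simp only [LiesOn, not_forall, not_lt, exists_prop] at h1 h2 h3 h4
  exact h ⟨⟨h1, h2⟩, h4, h3⟩

/-- The first pin plays the role of the origin, so no letter is lost: the second pin supplies a
numeral, and each later pin a direction in which it leaves the bounding box. -/
theorem IsProperPinRepresentation.exists_realizes {σ : FinPerm} {r : Fin σ.1 → Pin}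
    (h : IsProperPinRepresentation σ r) (hσ : 2 ≤ σ.1) :
    ∃ w, w.length = σ.1 ∧ Realizes w (extend r) ∧ Represents σ fun i => extend r i := by
  have hdir : ∀ i : Fin (σ.1 - 2), ∃ d, ∀ j ≤ (i : ℕ) + 1,
      Beyond d (extend r (i + 2)) (extend r j) := by
    intro i
    obtain ⟨d, hd⟩ := exists_liesOn_of_not_inBoundingBox
      (h.pinSequence.outside ⟨i + 2, by omega⟩ ⟨i + 1, by omega⟩ rfl)
    refine ⟨d, fun j hj => ?_⟩
    rw [extend_of_lt r (i := i + 2) (by omega)]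
    exact liesOn_iff.1 hd _ (extend_mem_firstPins r (by omega) (Nat.lt_succ_of_le hj))
  choose d hd using hdir
  have h01 := h.pinSequence.distinct ⟨1, by omega⟩ ⟨0, by omega⟩ (by simp)
  rw [← extend_of_lt r (by omega), ← extend_of_lt r (i := 0) (by omega)] at h01
  obtain ⟨q, hq⟩ := exists_inQuadrant h01.1 h01.2
  obtain ⟨t, ht⟩ := exists_mem_phiValues q (List.ofFn d)
  refine ⟨t, by rw [length_of_mem_phiValues ht, List.length_ofFn]; omega,
    realizes_of_separates hq (fun i c hc => ?_) ht, ?_⟩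
  · obtain ⟨hi, rfl⟩ := List.getElem?_eq_some_iff.1 hc
    rw [List.length_ofFn] at hi
    rw [List.getElem_ofFn]
    refine ⟨hd ⟨i, hi⟩, ?_⟩
    rw [extend_of_lt r (i := i + 2) (by omega), extend_of_lt r (i := i + 1) (by omega)]
    refine (h.proper ⟨i + 2, by omega⟩ ⟨i + 1, by omega⟩ rfl (Nat.succ_pos i)).mono ?_
    rintro _ ⟨k, hk, rfl⟩
    exact extend_mem_firstPins r (by omega) (Nat.lt_succ_of_le hk)
  · obtain ⟨e, he⟩ := h.orderIso
    exact ⟨e, fun i j => by simpa [extend] using he i j⟩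

/-! ### Patterns and factors -/

/-- Anchored at `p 0`, the pins of the factor inside `w` realize `f` as well, hence compare exactly
like `p'`. -/
theorem Realizes.isPattern_of_factor {π σ : FinPerm} {w s f t : List Dir} {p p' : ℕ → Pin}
    (hw : Realizes w p) (hσ : Represents σ fun i => p i) (hlen : w.length = σ.1)
    (hf : Realizes f p') (hwf : w = s ++ f ++ t) (k : Fin π.1 → ℕ) (hk : ∀ i, k i < f.length)
    (hπ : Represents π fun i => p' (k i)) : IsPattern π σ := by
  have hlen' : s.length + f.length + t.length = w.length := by simp [hwf]; omega
  have hr : Realizes f (PinPerm.subsequence p 0 s.length) := by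
    refine hw.subsequence (Nat.zero_le _) (.inl rfl) (by omega) fun j hj => ?_
    rw [hwf, List.append_assoc, List.getElem?_append_right (by omega), Nat.add_sub_cancel_left,
      List.getElem?_append_left hj]
  have hidx : ∀ j, ∃ l, j < f.length → l < σ.1 ∧ PinPerm.subsequence p 0 s.length j = p l := by
    intro j
    cases j with
    | zero => exact ⟨0, fun _ => ⟨by omega, rfl⟩⟩
    | succ j => exact ⟨s.length + 1 + j, fun _ => ⟨by omega, rfl⟩⟩
  choose l hl using hidx
  refine hπ.isPattern hσ (fun i => ⟨l (k i), (hl _ (hk i)).1⟩) fun i j => ?_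
  simp only
  rw [← (hl _ (hk i)).2, ← (hl _ (hk j)).2]
  exact hf.lt_iff hr (hk i) (hk j)

theorem Realizes.isPattern_of_mem_E {π σ : FinPerm} {w f : List Dir} {p : ℕ → Pin}
    (hw : Realizes w p) (hσ : Represents σ fun i => p i) (hlen : w.length = σ.1)
    (hf : f ∈ E π) (hfw : f <:+: w) : IsPattern π σ := by
  obtain ⟨s, t, rfl⟩ := hfw
  rcases hf with ⟨q, d, u, h, rfl⟩ | ⟨-, k, q, u, h, x, -, v, hv, rfl⟩
  · obtain ⟨hl, p', hp', hrep⟩ := h.exists_realizes_of_strictWord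
    exact hw.isPattern_of_factor hσ hlen hp' rfl (fun i => i + 1) (by omega) hrep
  · obtain ⟨hl, p', hp', hrep⟩ := h.exists_realizes_of_quasiStrictWord hv
    -- The turn `x` is absorbed into the prefix: it is irrelevant in this direction of the argument.
    exact hw.isPattern_of_factor hσ hlen hp' (s := s ++ x) (t := t) (by simp) (fun i => i) (by omega) hrep

theorem Realizes.isChain {w : List Dir} {p : ℕ → Pin} (hw : Realizes w p) :
    w.IsChain fun a b => ¬ (a.IsHorizontal ↔ b.IsHorizontal) := by
  rw [List.isChain_iff_getElem]
  intro i hi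
  exact hw.turn i _ _ (List.getElem?_eq_getElem _) (List.getElem?_eq_getElem _)

theorem mem_turns {a b : Dir} (h : a.Turn b) : [a, b] ∈ turns := by
  cases a <;> cases b <;> simp_all [turns, Dir.Turn, Dir.IsHorizontal]

theorem mem_nonTurns {f : List Dir} : f ∈ nonTurns ↔ ∃ a b : Dir, f = [a, b] ∧ ¬ a.Turn b := by
  constructor
  · intro h
    simp only [nonTurns, Set.mem_insert_iff, Set.mem_singleton_iff] at h
    rcases h with rfl | rfl | rfl | rfl | rfl | rfl | rfl | rfl <;>
      exact ⟨_, _, rfl, by simp [Dir.Turn, Dir.IsHorizontal]⟩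
  · rintro ⟨a, b, rfl, h⟩
    cases a <;> cases b <;> simp_all [nonTurns, Dir.Turn, Dir.IsHorizontal]

theorem turn_of_avoidsFactors {w : List Dir} (h : AvoidsFactors nonTurns w) (i : ℕ) (a b : Dir)
    (ha : w[i]? = some a) (hb : w[i + 1]? = some b) : a.Turn b := by
  by_contra hab
  refine h [a, b] (mem_nonTurns.2 ⟨a, b, rfl, hab⟩) ⟨w.take i, w.drop (i + 2), ?_⟩
  obtain ⟨hi, rfl⟩ := List.getElem?_eq_some_iff.1 ha
  obtain ⟨hi', rfl⟩ := List.getElem?_eq_some_iff.1 hb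
  conv_rhs => rw [← List.take_append_drop i w, List.drop_eq_getElem_cons hi,
    List.drop_eq_getElem_cons hi']
  simp

theorem Realizes.avoidsFactors_nonTurns {w : List Dir} {p : ℕ → Pin} (hw : Realizes w p) :
    AvoidsFactors nonTurns w := by
  rintro f hf ⟨s, t, rfl⟩
  obtain ⟨a, b, rfl, hab⟩ := mem_nonTurns.1 hf
  exact hab (hw.turn s.length a b (by simp) (by simp))

/-- In an occurrence of a simple permutation in the permutation of an alternating word, the pins
are consecutive except possibly for the first one. -/
theorem Realizes.strictMono_eq_add {π : FinPerm} {w : List Dir} {p : ℕ → Pin} (hw : Realizes w p)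
    (hπ : IsSimple π) {s : Fin π.1 → ℕ} (hs : StrictMono s) (hsw : ∀ i, s i < w.length)
    (hrep : Represents π fun i => p (s i)) (i : ℕ) (hi : i + 1 < π.1) :
    s ⟨i + 1, hi⟩ = s ⟨1, by omega⟩ + i := by
  induction i with
  | zero => rfl
  | succ i ih =>
    have h1 := ih (by omega)
    have h2 : s ⟨i + 1, by omega⟩ < s ⟨i + 2, hi⟩ := hs (by simp)
    by_contra hne
    change ¬ s ⟨i + 2, hi⟩ = _ at hne
    -- After a gap, every remaining chosen pin comes at least two steps after each of the first `i +
    -- 2`, so it cuts none of their pairs.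
    refine hπ.exists_cut hrep (k := i + 2) (by omega) hi fun a b c ha hb hc => ?_
    have h3 : s a ≤ s ⟨i + 1, by omega⟩ := hs.monotone (Fin.le_def.2 (by simp; omega))
    have h4 : s b ≤ s ⟨i + 1, by omega⟩ := hs.monotone (Fin.le_def.2 (by simp; omega))
    have h5 : s ⟨i + 2, hi⟩ ≤ s c := hs.monotone (Fin.le_def.2 (by simp; omega))
    exact hw.not_cut (by omega) (by omega) (hsw c)

/-- Leaving `p 0` out of `σ` keeps it available as an origin for the pin word of `π`, and leaves
enough letters before the occurrence to complete a factor. -/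
theorem Realizes.exists_mem_E {π σ : FinPerm} {w : List Dir} {p : ℕ → Pin} (hw : Realizes w p)
    (hσ : Represents σ fun i => p (i + 1)) (hlen : w.length = σ.1 + 1) (hπ : IsSimple π)
    (hπ2 : 2 ≤ π.1) (h : IsPattern π σ) : ∃ f ∈ E π, f <:+: w := by
  obtain ⟨g, hg, hrep⟩ := h.exists_strictMono hσ
  set s : Fin π.1 → ℕ := fun i => g i + 1 with hs
  have hsmono : StrictMono s := fun i j hij => Nat.succ_lt_succ (hg hij)
  have hsw : ∀ i, s i < w.length := fun i => by simp only [hs]; omega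
  have hrep : Represents π fun i => p (s i) := hrep
  have hadd := hw.strictMono_eq_add hπ hsmono hsw hrep
  obtain ⟨m, hm⟩ : ∃ m, π.1 = m + 2 := ⟨π.1 - 2, by omega⟩
  set s0 := s ⟨0, by omega⟩ with hs0
  set s1 := s ⟨1, by omega⟩ with hs1
  have h01 : s0 < s1 := hsmono (by simp)
  have h0 : 0 < s0 := Nat.succ_pos _
  have hlast : s1 + m < w.length := by
    rw [← hadd m (by omega)]
    exact hsw _
  have hinfix : ∀ a l, (w.drop a).take l <:+: w := fun a l =>
    (List.take_prefix _ _).isInfix.trans (List.drop_suffix _ _).isInfix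
  have hget : ∀ a l j, j < ((w.drop a).take l).length → ((w.drop a).take l)[j]? = w[a + j]? := by
    intro a l j hj
    rw [List.length_take] at hj
    rw [List.getElem?_take_of_lt (by omega), List.getElem?_drop]
  have hlength : ∀ a l, a + l ≤ w.length → ((w.drop a).take l).length = l := fun a l hl => by
    rw [List.length_take, List.length_drop]
    omega
  by_cases hgap : s1 = s0 + 1
  -- Consecutive pins: the factor starts one letter early, since with origin `p 0` the quadrant of
  -- `p s0` is given by the letters at `s0 - 1` and `s0`.
  · have hl := hlength (s0 - 1) (m + 3) (by omega)
    have hr := hw.subsequence (i := 0) (Nat.zero_le _) (.inl rfl) (by omega)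
      (hget (s0 - 1) (m + 3))
    have hfw := hinfix (s0 - 1) (m + 3)
    generalize (w.drop (s0 - 1)).take (m + 3) = f at hl hr hfw
    obtain ⟨a, b, d, u, rfl⟩ : ∃ a b d u, f = a :: b :: d :: u := by
      match f, hl with
      | a :: b :: d :: u, _ => exact ⟨a, b, d, u, rfl⟩
    obtain ⟨q, hq⟩ := exists_mem_phiOne (hr.turn 0 a b rfl rfl)
    have hmem : a :: b :: d :: u ∈ phiValues q (d :: u) :=
      mem_phiValues.2 ⟨a, b, hq, by simpa using hr.turn 1 b d rfl rfl, rfl⟩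
    refine ⟨_, .inl ⟨q, d, u, hr.isPinWordOf_strictWord hq (by simp at hl; omega) ?_, hmem⟩, hfw⟩
    convert hrep using 2 with i
    rcases i with ⟨i, hi⟩
    simp only [PinPerm.subsequence]
    congr 1
    match i with
    | 0 => omega
    | i + 1 => rw [hadd i hi]; omega
  -- A gap together with `0 < s0` gives `3 ≤ s1`, which makes room for the turn `x` before the
  -- factor starting at `s1 - 1`. That factor is realized from both anchors `p s0` and `p 0`; the
  -- latter becomes the origin.
  · have hl := hlength (s1 - 3) (m + 4) (by omega)
    have hfw := hinfix (s1 - 3) (m + 4)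
    have hr0 := hw.subsequence (i := 0) (a := s1 - 3) (Nat.zero_le _) (.inl rfl) (by omega)
      (hget (s1 - 3) (m + 4))
    have hlt := hlength (s1 - 1) (m + 2) (by omega)
    have hr := hw.subsequence (i := s0) (a := s1 - 1) (by omega) (by omega) (by omega)
      (hget (s1 - 1) (m + 2))
    have hr' := hw.subsequence (i := 0) (a := s1 - 1) (by omega) (by omega) (by omega)
      (hget (s1 - 1) (m + 2))
    have hdrop : ((w.drop (s1 - 3)).take (m + 4)).drop 2 = (w.drop (s1 - 1)).take (m + 2) := by
      rw [List.drop_take, List.drop_drop]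
      congr 2
      omega
    rw [← hdrop] at hr hr'
    generalize (w.drop (s1 - 3)).take (m + 4) = f at *
    obtain ⟨x, y, a, b, u, rfl⟩ : ∃ x y a b u, f = x :: y :: a :: b :: u := by
      match f, hl with
      | x :: y :: a :: b :: u, _ => exact ⟨x, y, a, b, u, rfl⟩
    simp only [List.drop_succ_cons, List.drop_zero] at hr hr'
    obtain ⟨q, hq⟩ := exists_mem_phiOne (hr.turn 0 a b rfl rfl)
    have hmem : a :: b :: u ∈ phiValues q u :=
      mem_phiValues.2 ⟨a, b, hq, fun d hd => hr.turn 1 b d rfl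
        (by simpa [List.head?_eq_getElem?] using hd), rfl⟩
    have hne := hw.ne h0.ne' (hsw _) (by omega)
    obtain ⟨k, hk⟩ := hr.exists_isPinWordOf_quasiStrictWord (π := π) hr' (fun _ => rfl) hne.1 hne.2 hq
      (by simp at hl; omega) (by
        convert hrep using 2 with i
        rcases i with ⟨i, hi⟩
        match i with
        | 0 => rfl
        | i + 1 =>
          simp only [PinPerm.subsequence]
          rw [hadd i hi]
          congr 1)
    exact ⟨_, .inr ⟨⟨by simp, hr0.isChain⟩, k, q, u, hk, [x, y],
      mem_turns (hr0.turn 0 x y rfl rfl), _, hmem, rfl⟩, hfw⟩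

/-! ### Finiteness -/

theorem finite_setOf_size_lt (n : ℕ) : {σ : FinPerm | σ.size < n}.Finite := by
  refine (Set.finite_range fun x : Σ k : Fin n, Equiv.Perm (Fin k) =>
    (⟨x.1, x.2⟩ : FinPerm)).subset ?_
  rintro ⟨k, σ⟩ hk
  exact ⟨⟨⟨k, hk⟩, σ⟩, rfl⟩

instance : Finite Dir :=
  Finite.of_injective (β := Fin 4)
    (fun d => match d with
      | .L => 0
      | .R => 1
      | .U => 2
      | .D => 3)
    (by intro a b; cases a <;> cases b <;> simp)

theorem finite_iff_not_unbounded {α : Type*} {S : Set α} (size : α → ℕ)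
    (h : ∀ n, {a | size a < n}.Finite) : S.Finite ↔ ¬ ∀ n, ∃ a ∈ S, n ≤ size a := by
  constructor
  · intro hS hn
    obtain ⟨N, hN⟩ := (hS.image size).bddAbove
    obtain ⟨a, ha, ha'⟩ := hn (N + 1)
    have := hN ⟨a, ha, rfl⟩
    omega
  · intro hn
    push Not at hn
    obtain ⟨n, hn⟩ := hn
    exact (h n).subset fun a ha => hn a ha

/-- Strict pin words gain one letter under `φ`; quasi-strict ones keep their length and gain the two
letters of `x`. -/
theorem length_le_of_mem_E {π : FinPerm} {f : List Dir} (h : f ∈ E π) : f.length ≤ π.1 + 2 := by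
  rcases h with ⟨q, d, u, h, rfl⟩ | ⟨-, k, q, u, h, x, hx, v, hv, rfl⟩
  · have := h.exists_realizes_of_strictWord.1
    omega
  · have := (h.exists_realizes_of_quasiStrictWord hv).1
    have hx : x.length = 2 := by
      simp only [turns, Set.mem_insert_iff, Set.mem_singleton_iff] at hx
      rcases hx with rfl | rfl | rfl | rfl | rfl | rfl | rfl | rfl <;> rfl
    rw [List.length_append]
    omega

theorem finite_E (π : FinPerm) : (E π).Finite :=
  (List.finite_length_lt Dir (π.1 + 3)).subset fun _ hf => Nat.lt_succ_of_le (length_le_of_mem_E hf)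

theorem finite_forbiddenFactors {B : Set FinPerm} (hB : B.Finite) :
    (forbiddenFactors B).Finite :=
  (hB.biUnion fun π _ => finite_E π).union (by simp [nonTurns])

/-! ### Proper pin-permutations and alternating words -/

theorem IsProperPinPerm.exists_avoidsFactors {B : Set FinPerm} {σ : FinPerm}
    (h : IsProperPinPerm σ) (hσ : σ ∈ Av B) (h2 : 2 ≤ σ.size) :
    ∃ w : List Dir, w.length = σ.size ∧ AvoidsFactors (forbiddenFactors B) w := by
  obtain ⟨r, hr⟩ := h
  obtain ⟨w, hlen, hw, hrep⟩ := hr.exists_realizes h2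
  refine ⟨w, hlen, ?_⟩
  rintro f (hf | hf) hfw
  · simp only [Set.mem_iUnion, exists_prop] at hf
    obtain ⟨π, hπ, hf⟩ := hf
    exact hσ π hπ (hw.isPattern_of_mem_E hrep hlen hf hfw)
  · exact hw.avoidsFactors_nonTurns f hf hfw

/-- Each direction yields a separation from the origin and the earlier pins together, which survives
the removal of the origin. -/
theorem IsPinWordOf.isProperPinPerm {σ : FinPerm} {q : Numeral} {d : Dir} {u : List Dir}
    (h : IsPinWordOf (strictWord q d u) σ) : IsProperPinPerm σ := by
  obtain ⟨p, -, hrep, hlen, henc⟩ := h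
  have hlen' : u.length + 2 = σ.1 := by simpa [strictWord] using hlen
  refine ⟨_, hrep, fun i j hij hj => ?_⟩
  obtain ⟨i, hi⟩ := i
  obtain ⟨j, hj'⟩ := j
  obtain rfl : i = j + 1 := hij
  have hl := henc ⟨j + 1, hi⟩
  have : (strictWord q d u)[j + 1]'(by simp [strictWord]; omega) =
      .dir ((d :: u)[j]'(by simp; omega)) := by
    cases j <;> simp [strictWord]
  simp only [List.get_eq_getElem, Fin.val_cast, this] at hl
  refine hl.2.1.mono ?_
  rintro _ ⟨k, hk, rfl⟩
  exact ⟨k.succ, by simpa using hk, rfl⟩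

theorem AvoidsFactors.exists_isProperPinPerm {B : Set FinPerm} (hB : ∀ π ∈ B, IsSimple π)
    (hB2 : ∀ π ∈ B, 2 ≤ π.size) {w : List Dir} (hw : AvoidsFactors (forbiddenFactors B) w)
    (hlen : 3 ≤ w.length) : ∃ σ ∈ Av B, σ.size + 1 = w.length ∧ IsProperPinPerm σ := by
  obtain ⟨a, b, d, u, rfl⟩ : ∃ a b d u, w = a :: b :: d :: u := by
    match w, hlen with
    | a :: b :: d :: u, _ => exact ⟨a, b, d, u, rfl⟩
  have hr := realizes_spiral (turn_of_avoidsFactors fun f hf => hw f (.inr hf))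
  generalize spiral (a :: b :: d :: u) = p at hr
  have hne : ∀ i j : Fin (u.length + 2), i ≠ j →
      (p (i + 1)).1 ≠ (p (j + 1)).1 ∧ (p (i + 1)).2 ≠ (p (j + 1)).2 := fun i j hij =>
    hr.ne (by omega) (by simp; omega) (by simp; omega)
  obtain ⟨σ, hσ⟩ := exists_represents (fun i : Fin (u.length + 2) => p (i + 1))
    (fun i j h => by_contra fun hij => (hne i j hij).1 h)
    (fun i j h => by_contra fun hij => (hne i j hij).2 h)
  obtain ⟨q, hq⟩ := exists_mem_phiOne (hr.turn 0 a b rfl rfl)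
  refine ⟨⟨_, σ⟩, fun π hπ hpat => ?_, rfl, (hr.isPinWordOf_strictWord hq rfl hσ).isProperPinPerm⟩
  obtain ⟨f, hf, hfw⟩ := hr.exists_mem_E hσ rfl (hB π hπ) (hB2 π hπ) hpat
  exact hw f (.inl (Set.mem_biUnion hπ hf)) hfw

end PinPerm

theorem theorem2 (B : Set PinPerm.FinPerm) (hB : PinPerm.IsWreathClosedBasis B)
    (hsize : ∀ π ∈ B, 2 ≤ π.size) :
    (B.Finite → (PinPerm.forbiddenFactors B).Finite) ∧
    ((∀ n : ℕ, ∃ σ ∈ PinPerm.Av B, n ≤ σ.size ∧ PinPerm.IsProperPinPerm σ) ↔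
      (∀ n : ℕ, ∃ w : List PinPerm.Dir, n ≤ w.length ∧
        PinPerm.AvoidsFactors (PinPerm.forbiddenFactors B) w)) ∧
    ({σ | σ ∈ PinPerm.Av B ∧ PinPerm.IsProperPinPerm σ}.Finite ↔
      {w : List PinPerm.Dir |
        PinPerm.AvoidsFactors (PinPerm.forbiddenFactors B) w}.Finite) := by
  have key : (∀ n : ℕ, ∃ σ ∈ PinPerm.Av B, n ≤ σ.size ∧ PinPerm.IsProperPinPerm σ) ↔
      (∀ n : ℕ, ∃ w : List PinPerm.Dir, n ≤ w.length ∧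
        PinPerm.AvoidsFactors (PinPerm.forbiddenFactors B) w) := by
    constructor
    · intro h n
      -- The shift guarantees two pins, needed to read off a quadrant.
      obtain ⟨σ, hσ, hn, hp⟩ := h (n + 2)
      obtain ⟨w, hw, hw'⟩ := hp.exists_avoidsFactors hσ (by omega)
      exact ⟨w, by omega, hw'⟩
    · intro h n
      -- Three letters give a strict pin word, and the permutation is one shorter than the word.
      obtain ⟨w, hn, hw⟩ := h (n + 3)
      obtain ⟨σ, hσ, hlen, hp⟩ := hw.exists_isProperPinPerm hB.simple hsize (by omega)
      exact ⟨σ, hσ, by omega, hp⟩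
  refine ⟨PinPerm.finite_forbiddenFactors, key, ?_⟩
  rw [PinPerm.finite_iff_not_unbounded PinPerm.FinPerm.size PinPerm.finite_setOf_size_lt,
    PinPerm.finite_iff_not_unbounded List.length (List.finite_length_lt PinPerm.Dir)]
  refine not_congr (Iff.trans ?_ (key.trans ?_))
  · exact forall_congr' fun n => exists_congr fun σ => by
      simp only [Set.mem_ofPred_eq]; tauto
  · exact forall_congr' fun n => exists_congr fun w => and_comm
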